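/- A Petri net $N=(P,T,F)$ consists of disjoint non-empty sets $P$ (places) and $T$ (transitions) and a relation $F\subseteq (P\times T)\cup(T\times P)$ such that the graph $(P\cup T,F)$ is weakly connected. For $t\in T$ let ${}^\bullet t=\{p\mid (p,t)\in F\}$ and $t^\bullet=\{p\mid (t,p)\in F\}$. The net is strongly connected if there is a directed path in $(P\cup T,F)$ from every node to every node, and free-choice if for all $t_1,t_2\in T$ either ${}^\bullet t_1={}^\bullet t_2$ or ${}^\bullet t_1\cap{}^\bullet t_2=\emptyset$. A marking is a multiset of places $M:P\to\mathbb{N}$. A transition $t$ is enabled in $M$ if $M(p)\ge 1$ for all $p\in{}^\bullet t$; firing it then yields the marking $(M-\mathbf 1_{{}^\bullet t})+\mathbf 1_{t^\bullet}$. Write $\mathrm{en}(N,M)$ for the set of transitions enabled in $M$, and $R(N,M)$ for the set of markings obtained from $M$ by firing finite (possibly empty) sequences of transitions. The cluster of a node $x\in P\cup T$ is the smallest set of nodes that contains $x$, contains with each of its places $p$ every transition $t$ with $(p,t)\in F$, and contains with each of its transitions $t$ every place in ${}^\bullet t$. A home cluster of $(N,M)$ is a cluster $C$ (of some node) such that the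 marking $\mathrm{Mrk}(C)=\mathbf 1_{C\cap P}$ satisfies $\mathrm{Mrk}(C)\in R(N,M')$ for every $M'\in R(N,M)$. **Proposition.** Let $N$ be a strongly connected free-choice Petri net and $M$ a marking of $N$ such that $(N,M)$ has a home cluster. Then $(N,M)$ is 1. live: for every $M'\in R(N,M)$ and every $t\in T$ there is $M''\in R(N,M')$ that enables $t$; 2. safe: $M'(p)\le 1$ for every $M'\in R(N,M)$ and every $p\in P$; 3. lucent: for all $M_1,M_2\in R(N,M)$, $\mathrm{en}(N,M_1)=\mathrm{en}(N,M_2)$ implies $M_1=M_2$. -/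

import Mathlib

/-- A marking is a multiset of places, given by its multiplicity function. -/
abbrev Marking (P : Type*) := P → ℕ

/-- The marking with exactly one token in every place of `S`. -/
noncomputable def Marking.ofSet {P : Type*} (S : Set P) : Marking P := S.indicator 1

/-- The flow relation on the nodes `P ⊕ T` determined by its arcs from places to transitions
and its arcs from transitions to places. -/
def flowRel {P T : Type*} (arcPT : P → T → Prop) (arcTP : T → P → Prop) :
    P ⊕ T → P ⊕ T → Prop
  | .inl p, .inr t => arcPT p t
  | .inr t, .inl p => arcTP t p
  | _, _ => False

/-- A Petri net with set of places `P` and set of transitions `T` (distinct types, so they are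
disjoint): both sets are non-empty, and the graph on `P ⊕ T` is weakly connected, i.e. any two
nodes are related by the equivalence relation generated by the arcs. -/
structure PetriNet (P T : Type*) where
  /-- the arcs in `P × T` -/
  arcPT : P → T → Prop
  /-- the arcs in `T × P` -/
  arcTP : T → P → Prop
  nonempty_places : Nonempty P
  nonempty_transitions : Nonempty T
  weaklyConnected : ∀ x y : P ⊕ T, Relation.EqvGen (flowRel arcPT arcTP) x y

namespace PetriNet

/-- The flow relation `F`. -/
def flow {P T : Type*} (N : PetriNet P T) : P ⊕ T → P ⊕ T → Prop :=
  flowRel N.arcPT N.arcTP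

/-- The input places of a transition. -/
def pre {P T : Type*} (N : PetriNet P T) (t : T) : Set P := {p | N.flow (.inl p) (.inr t)}

/-- The output places of a transition. -/
def post {P T : Type*} (N : PetriNet P T) (t : T) : Set P := {p | N.flow (.inr t) (.inl p)}

/-- Each input place of `t` contains at least one token. -/
def Enabled {P T : Type*} (N : PetriNet P T) (M : Marking P) (t : T) : Prop :=
  ∀ p ∈ N.pre t, 1 ≤ M p

/-- The set of transitions enabled in `M`. -/
def en {P T : Type*} (N : PetriNet P T) (M : Marking P) : Set T := {t | N.Enabled M t}

/-- `t` is enabled in `M`, and firing it results in `M'`. -/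
def Fires {P T : Type*} (N : PetriNet P T) (M : Marking P) (t : T) (M' : Marking P) : Prop :=
  N.Enabled M t ∧ M' = (M - Marking.ofSet (N.pre t)) + Marking.ofSet (N.post t)

/-- Firing the sequence `σ` of transitions in `M` is possible and results in `M'`. -/
def FiresSeq {P T : Type*} (N : PetriNet P T) : Marking P → List T → Marking P → Prop
  | M, [], M' => M = M'
  | M, t :: σ, M' => ∃ M₁, N.Fires M t M₁ ∧ N.FiresSeq M₁ σ M'

/-- The set `R(N, M)` of the markings reachable from `M`. -/
def reachable {P T : Type*} (N : PetriNet P T) (M : Marking P) : Set (Marking P) :=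
  {M' | ∃ σ : List T, N.FiresSeq M σ M'}

/-- From every reachable marking, every transition can become enabled again. -/
def Live {P T : Type*} (N : PetriNet P T) (M : Marking P) : Prop :=
  ∀ M' ∈ N.reachable M, ∀ t : T, ∃ M'' ∈ N.reachable M', N.Enabled M'' t

/-- No place ever holds more than `k` tokens. -/
def KBounded {P T : Type*} (N : PetriNet P T) (k : ℕ) (M : Marking P) : Prop :=
  ∀ M' ∈ N.reachable M, ∀ p : P, M' p ≤ k

/-- Safe means 1-bounded. -/
def Safe {P T : Type*} (N : PetriNet P T) (M : Marking P) : Prop := N.KBounded 1 M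

/-- Reachable markings that enable the same transitions are equal. -/
def Lucent {P T : Type*} (N : PetriNet P T) (M : Marking P) : Prop :=
  ∀ M₁ ∈ N.reachable M, ∀ M₂ ∈ N.reachable M, N.en M₁ = N.en M₂ → M₁ = M₂

/-- `H` is reachable from every marking that is reachable from `M`. -/
def IsHomeMarking {P T : Type*} (N : PetriNet P T) (M H : Marking P) : Prop :=
  ∀ M' ∈ N.reachable M, H ∈ N.reachable M'

/-- Membership in the cluster of `x`: the smallest set of nodes that contains `x`, contains with
a place all its output transitions, and contains with a transition all its input places. -/
inductive InCluster {P T : Type*} (N : PetriNet P T) (x : P ⊕ T) : P ⊕ T → Prop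
  | self : InCluster N x x
  | output {p : P} {t : T} : InCluster N x (.inl p) → N.flow (.inl p) (.inr t) →
      InCluster N x (.inr t)
  | input {p : P} {t : T} : InCluster N x (.inr t) → N.flow (.inl p) (.inr t) →
      InCluster N x (.inl p)

/-- The cluster of the node `x`. -/
def cluster {P T : Type*} (N : PetriNet P T) (x : P ⊕ T) : Set (P ⊕ T) := {y | N.InCluster x y}

/-- The set of clusters of `N`. -/
def clusters {P T : Type*} (N : PetriNet P T) : Set (Set (P ⊕ T)) := Set.range N.cluster

/-- `Mrk(C)`: one token in every place of `C` and no other tokens. -/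
noncomputable def mrk {P T : Type*} (C : Set (P ⊕ T)) : Marking P :=
  Marking.ofSet {p | .inl p ∈ C}

/-- `C` is a home cluster of `(N, M)`. -/
def IsHomeCluster {P T : Type*} (N : PetriNet P T) (M : Marking P) (C : Set (P ⊕ T)) : Prop :=
  C ∈ N.clusters ∧ N.IsHomeMarking M (mrk C)

/-- There is a directed path between any two nodes. -/
def StronglyConnected {P T : Type*} (N : PetriNet P T) : Prop :=
  ∀ x y : P ⊕ T, Relation.ReflTransGen N.flow x y

/-- Any two transitions have equal or disjoint sets of input places. -/
def FreeChoice {P T : Type*} (N : PetriNet P T) : Prop :=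
  ∀ t₁ t₂ : T, N.pre t₁ = N.pre t₂ ∨ N.pre t₁ ∩ N.pre t₂ = ∅

end PetriNet

namespace PetriNet

variable {P T : Type*} {N : PetriNet P T}

/-! ### Marking arithmetic and firing sequences -/

/-! By free choice, the marking of the home cluster is `H`, one token on each input place of some
`t₀`. The crux is `IsHomeMarking.eq_zero_of_firesSeq_add`: if `K` is reachable and `K + L` can reach
`H`, then `L = 0`. Some `u` is enabled in `K`. The first transition of the run in the cluster of `u`
can be moved to the front and fired without `L`, which shortens the run. If there is none, the
tokens enabling `u` survive into `H`, so `u` is in the home cluster, and any further production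
would exceed `H`. Hence `H` is the only reachable marking that enables the home cluster.

The last firings per cluster on a way to `H` yield an acyclic choice `τ` of transitions. Firing `τ`
to exhaustion must end in `H`, since deadlock is impossible, and no transition fires twice. Token
balance then gives safety. For lucency, one `τ` serves both markings; equal enabled sets force the
same transitions to fire, and balance against the common end `H` makes the markings equal.

Liveness is independent of this: tokens can be pushed along directed paths, because a marked place
outside the home cluster must be emptied before `H` is reached. -/

theorem ofSet_apply_mem {S : Set P} {p : P} (h : p ∈ S) : Marking.ofSet S p = 1 := by
  simp [Marking.ofSet, h]

theorem ofSet_apply_notMem {S : Set P} {p : P} (h : p ∉ S) : Marking.ofSet S p = 0 := by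
  simp [Marking.ofSet, h]

theorem ofSet_apply_le_one (S : Set P) (p : P) : Marking.ofSet S p ≤ 1 := by
  by_cases h : p ∈ S
  · rw [ofSet_apply_mem h]
  · simp [ofSet_apply_notMem h]

open Classical in
/-- The number of tokens that the transitions of `σ` produce in `p`. -/
noncomputable def produced (N : PetriNet P T) (σ : List T) (p : P) : ℕ :=
  σ.countP (fun t => p ∈ N.post t)

open Classical in
/-- The number of tokens that the transitions of `σ` consume from `p`. -/
noncomputable def consumed (N : PetriNet P T) (σ : List T) (p : P) : ℕ :=
  σ.countP (fun t => p ∈ N.pre t)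

theorem produced_pos {σ : List T} {p : P} : 0 < N.produced σ p ↔ ∃ t ∈ σ, p ∈ N.post t := by
  simp [produced, List.countP_pos_iff]

theorem consumed_pos {σ : List T} {p : P} : 0 < N.consumed σ p ↔ ∃ t ∈ σ, p ∈ N.pre t := by
  simp [consumed, List.countP_pos_iff]

theorem produced_cons (t : T) (σ : List T) (p : P) :
    N.produced (t :: σ) p = N.produced σ p + Marking.ofSet (N.post t) p := by
  classical
  simp [produced, List.countP_cons, Marking.ofSet, Set.indicator_apply]

theorem consumed_cons (t : T) (σ : List T) (p : P) :
    N.consumed (t :: σ) p = N.consumed σ p + Marking.ofSet (N.pre t) p := by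
  classical
  simp [consumed, List.countP_cons, Marking.ofSet, Set.indicator_apply]

theorem Fires.apply_add {K K' : Marking P} {t : T} (h : N.Fires K t K') (p : P) :
    K' p + Marking.ofSet (N.pre t) p = K p + Marking.ofSet (N.post t) p := by
  obtain ⟨he, rfl⟩ := h
  have : Marking.ofSet (N.pre t) p ≤ K p := by
    by_cases hp : p ∈ N.pre t
    · rw [ofSet_apply_mem hp]
      exact he p hp
    · simp [ofSet_apply_notMem hp]
  simp only [Pi.add_apply, Pi.sub_apply]
  omega

theorem Enabled.exists_fires {K : Marking P} {t : T} (h : N.Enabled K t) : ∃ K', N.Fires K t K' :=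
  ⟨_, h, rfl⟩

theorem Fires.of_apply_add {K K' : Marking P} {t : T} (he : N.Enabled K t)
    (h : ∀ p, K' p + Marking.ofSet (N.pre t) p = K p + Marking.ofSet (N.post t) p) :
    N.Fires K t K' := by
  obtain ⟨K₁, hK₁⟩ := he.exists_fires
  have : K' = K₁ := by
    funext p
    have h1 := h p
    have h2 := hK₁.apply_add p
    omega
  exact this ▸ hK₁

theorem FiresSeq.apply_add {σ : List T} : ∀ {K K' : Marking P}, N.FiresSeq K σ K' → ∀ p,
    K' p + N.consumed σ p = K p + N.produced σ p := by
  induction σ with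
  | nil =>
    intro K K' h p
    obtain rfl : K = K' := h
    simp [produced, consumed]
  | cons t σ ih =>
    rintro K K' ⟨K₁, h₁, h₂⟩ p
    have h1 := h₁.apply_add p
    have h2 := ih h₂ p
    rw [produced_cons, consumed_cons]
    omega

theorem firesSeq_append {σ τ : List T} : ∀ {K K' : Marking P},
    N.FiresSeq K (σ ++ τ) K' ↔ ∃ K₁, N.FiresSeq K σ K₁ ∧ N.FiresSeq K₁ τ K' := by
  induction σ with
  | nil => simp [FiresSeq]
  | cons t σ ih =>
    intro K K'
    simp only [List.cons_append, FiresSeq, ih]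
    constructor
    · rintro ⟨K₁, h₁, K₂, h₂, h₃⟩
      exact ⟨K₂, ⟨K₁, h₁, h₂⟩, h₃⟩
    · rintro ⟨K₂, ⟨K₁, h₁, h₂⟩, h₃⟩
      exact ⟨K₁, h₁, K₂, h₂, h₃⟩

theorem mem_reachable_self (K : Marking P) : K ∈ N.reachable K := ⟨[], rfl⟩

theorem reachable_trans {K₁ K₂ K₃ : Marking P} (h : K₂ ∈ N.reachable K₁)
    (h' : K₃ ∈ N.reachable K₂) : K₃ ∈ N.reachable K₁ := by
  obtain ⟨σ, hσ⟩ := h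
  obtain ⟨τ, hτ⟩ := h'
  exact ⟨σ ++ τ, firesSeq_append.2 ⟨_, hσ, hτ⟩⟩

theorem Fires.mem_reachable {K K' : Marking P} {t : T} (h : N.Fires K t K') :
    K' ∈ N.reachable K := ⟨[t], K', h, rfl⟩

/-- If a marked place becomes empty, then at some point a transition consuming from it is
enabled. -/
theorem FiresSeq.exists_enabled {σ : List T} {p : P} : ∀ {K K' : Marking P},
    N.FiresSeq K σ K' → 1 ≤ K p → K' p = 0 →
    ∃ K₁ ∈ N.reachable K, ∃ u, p ∈ N.pre u ∧ N.Enabled K₁ u := by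
  induction σ with
  | nil =>
    intro K K' h h1 h0
    obtain rfl : K = K' := h
    omega
  | cons t σ ih =>
    rintro K K' ⟨K₁, h₁, h₂⟩ h1 h0
    by_cases hp : p ∈ N.pre t
    · exact ⟨K, mem_reachable_self K, t, hp, h₁.1⟩
    · have := h₁.apply_add p
      rw [ofSet_apply_notMem hp] at this
      obtain ⟨K₂, hK₂, h⟩ := ih h₂ (by omega) h0
      exact ⟨K₂, reachable_trans h₁.mem_reachable hK₂, h⟩

/-- A transition that is enabled already can be moved to the front of a firing sequence, provided
that no earlier transition competes for its tokens. -/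
theorem FiresSeq.expedite {ρ₁ ρ₂ : List T} {v : T} : ∀ {K K' Y : Marking P},
    N.FiresSeq K (ρ₁ ++ v :: ρ₂) Y → (∀ w ∈ ρ₁, Disjoint (N.pre w) (N.pre v)) →
    N.Fires K v K' → N.FiresSeq K' (ρ₁ ++ ρ₂) Y := by
  induction ρ₁ with
  | nil =>
    rintro K K' Y ⟨K₁, h₁, h₂⟩ - h
    obtain rfl : K' = K₁ := h.2.trans h₁.2.symm
    exact h₂
  | cons w ρ₁ ih =>
    rintro K K' Y ⟨K₁, h₁, h₂⟩ hd h
    have hdw : Disjoint (N.pre w) (N.pre v) := hd w (by simp)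
    have hv : N.Enabled K₁ v := fun p hp => by
      have h1 := h₁.apply_add p
      rw [ofSet_apply_notMem (Set.disjoint_right.1 hdw hp)] at h1
      have := h.1 p hp
      omega
    obtain ⟨K₂, hK₂⟩ := hv.exists_fires
    refine ⟨K₂, Fires.of_apply_add (fun p hp => ?_) fun p => ?_,
      ih h₂ (fun u hu => hd u (by simp [hu])) hK₂⟩
    · have h1 := h.apply_add p
      rw [ofSet_apply_notMem (Set.disjoint_left.1 hdw hp)] at h1
      have := h₁.1 p hp
      omega
    · have h1 := h.apply_add p
      have h2 := h₁.apply_add p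
      have h3 := hK₂.apply_add p
      omega

/-! ### Consequences of strong connectedness and the free-choice property -/

theorem StronglyConnected.pre_nonempty (h : N.StronglyConnected) (t : T) :
    (N.pre t).Nonempty := by
  obtain ⟨p⟩ := N.nonempty_places
  rcases (h (.inl p) (.inr t)).cases_tail with h' | ⟨y, -, hy⟩
  · cases h'
  · rcases y with q | u
    · exact ⟨q, hy⟩
    · exact hy.elim

theorem StronglyConnected.post_nonempty (h : N.StronglyConnected) (t : T) :
    (N.post t).Nonempty := by
  obtain ⟨p⟩ := N.nonempty_places
  rcases (h (.inr t) (.inl p)).cases_head with h' | ⟨y, hy, -⟩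
  · cases h'
  · rcases y with q | u
    · exact ⟨q, hy⟩
    · exact hy.elim

theorem StronglyConnected.exists_mem_pre (h : N.StronglyConnected) (p : P) :
    ∃ t, p ∈ N.pre t := by
  obtain ⟨t⟩ := N.nonempty_transitions
  rcases (h (.inl p) (.inr t)).cases_head with h' | ⟨y, hy, -⟩
  · cases h'
  · rcases y with q | u
    · exact hy.elim
    · exact ⟨u, hy⟩

theorem FreeChoice.pre_eq (h : N.FreeChoice) {t u : T} {p : P} (ht : p ∈ N.pre t)
    (hu : p ∈ N.pre u) : N.pre t = N.pre u :=
  (h t u).resolve_right fun h' => by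
    have : p ∈ N.pre t ∩ N.pre u := ⟨ht, hu⟩
    rw [h'] at this
    exact this

theorem FreeChoice.disjoint_pre (h : N.FreeChoice) {t u : T} (hne : N.pre t ≠ N.pre u) :
    Disjoint (N.pre t) (N.pre u) :=
  Set.disjoint_left.2 fun _ ht hu => hne (h.pre_eq ht hu)

/-- In a strongly connected free-choice net, the places of a cluster are the input places of some
transition. -/
theorem exists_mrk_cluster_eq (hconn : N.StronglyConnected) (hfc : N.FreeChoice) (x : P ⊕ T) :
    ∃ t₀, mrk (N.cluster x) = Marking.ofSet (N.pre t₀) := by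
  have key : ∀ t₀, (∀ p, x = .inl p → p ∈ N.pre t₀) → (∀ t, x = .inr t → t = t₀) →
      N.InCluster x (.inr t₀) → mrk (N.cluster x) = Marking.ofSet (N.pre t₀) := by
    intro t₀ hp ht h₀
    have hsub : ∀ y, N.InCluster x y →
        (∀ p, y = .inl p → p ∈ N.pre t₀) ∧ (∀ t, y = .inr t → N.pre t = N.pre t₀) := by
      intro y hy
      induction hy with
      | self => exact ⟨hp, fun t h => by rw [ht t h]⟩
      | @output p t _ hf ih =>
        refine ⟨fun _ h => (by cases h), fun u hu => ?_⟩
        cases hu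
        exact hfc.pre_eq (p := p) hf (ih.1 p rfl)
      | @input p t _ hf ih =>
        refine ⟨fun q hq => ?_, fun _ h => (by cases h)⟩
        cases hq
        exact ih.2 t rfl ▸ hf
    unfold mrk
    congr 1
    ext p
    exact ⟨fun h => (hsub _ h).1 p rfl, fun h => InCluster.input h₀ h⟩
  rcases x with p | t
  · obtain ⟨t₀, h₀⟩ := hconn.exists_mem_pre p
    refine ⟨t₀, key t₀ (fun q hq => ?_) (fun _ h => (by cases h)) (.output .self h₀)⟩
    cases hq
    exact h₀
  · exact ⟨t, key t (fun _ h => (by cases h)) (fun u hu => (by cases hu; rfl)) .self⟩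

/-! ### The home marking -/

section Home

variable {M : Marking P} {t₀ : T}

theorem Enabled.ofSet_le {K : Marking P} {t : T} (h : N.Enabled K t) :
    Marking.ofSet (N.pre t) ≤ K := fun p => by
  by_cases hp : p ∈ N.pre t
  · rw [ofSet_apply_mem hp]
    exact h p hp
  · simp [ofSet_apply_notMem hp]

theorem enabled_ofSet_pre (t : T) : N.Enabled (Marking.ofSet (N.pre t)) t :=
  fun _ hp => (ofSet_apply_mem hp).ge

theorem IsHomeMarking.mem_reachable {H : Marking P} (h : N.IsHomeMarking M H) :
    H ∈ N.reachable M := h M (mem_reachable_self M)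

theorem IsHomeMarking.live (hconn : N.StronglyConnected) (hfc : N.FreeChoice)
    (hH : N.IsHomeMarking M (Marking.ofSet (N.pre t₀))) : N.Live M := by
  set H := Marking.ofSet (N.pre t₀) with hHdef
  obtain ⟨q, hq⟩ := hconn.pre_nonempty t₀
  have key : ∀ y, Relation.ReflTransGen N.flow (.inl q) y →
      (∀ p, y = .inl p → ∃ K ∈ N.reachable H, 1 ≤ K p) ∧
      (∀ t, y = .inr t → ∃ K ∈ N.reachable H, N.Enabled K t) := by
    intro y hy
    induction hy with
    | refl =>
      refine ⟨fun p hp => ?_, fun _ h => (by cases h)⟩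
      cases hp
      exact ⟨H, mem_reachable_self H, (ofSet_apply_mem hq).ge⟩
    | @tail y z _ hyz ih =>
      rcases z with p | t
      · refine ⟨fun p' hp => ?_, fun _ h => (by cases h)⟩
        cases hp
        rcases y with p' | t
        · exact hyz.elim
        obtain ⟨K, hK, he⟩ := ih.2 t rfl
        obtain ⟨K', hK'⟩ := he.exists_fires
        refine ⟨K', reachable_trans hK hK'.mem_reachable, ?_⟩
        have h1 := hK'.apply_add p
        rw [ofSet_apply_mem (show p ∈ N.post t from hyz)] at h1
        have h2 := ofSet_apply_le_one (N.pre t) p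
        by_cases hp : p ∈ N.pre t
        · have := he p hp
          omega
        · rw [ofSet_apply_notMem hp] at h1
          omega
      · refine ⟨fun _ h => (by cases h), fun t' ht => ?_⟩
        cases ht
        rcases y with p | t'
        swap
        · exact hyz.elim
        have hpt : p ∈ N.pre t := hyz
        by_cases hp : p ∈ N.pre t₀
        · refine ⟨H, mem_reachable_self H, ?_⟩
          unfold Enabled
          rw [hfc.pre_eq hpt hp]
          exact enabled_ofSet_pre t₀
        · obtain ⟨K, hK, h1⟩ := ih.1 p rfl
          obtain ⟨σ, hσ⟩ := hH K (reachable_trans hH.mem_reachable hK)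
          -- `H` has no token on `p`, so some `u` consuming from `p` becomes enabled; by free choice
          -- `t` is enabled with it.
          obtain ⟨K₁, hK₁, u, hu, he⟩ := hσ.exists_enabled h1 (ofSet_apply_notMem hp)
          refine ⟨K₁, reachable_trans hK hK₁, ?_⟩
          unfold Enabled
          rw [hfc.pre_eq hpt hu]
          exact he
  intro M' hM' t
  obtain ⟨K, hK, he⟩ := (key _ (hconn (.inl q) (.inr t))).2 t rfl
  exact ⟨K, reachable_trans (hH M' hM') hK, he⟩

theorem IsHomeMarking.exists_enabled (hH : N.IsHomeMarking M (Marking.ofSet (N.pre t₀)))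
    {K : Marking P} (hK : K ∈ N.reachable M) : ∃ u, N.Enabled K u := by
  obtain ⟨σ, hσ⟩ := hH K hK
  cases σ with
  | nil =>
    obtain rfl : K = _ := hσ
    exact ⟨t₀, enabled_ofSet_pre t₀⟩
  | cons u σ =>
    obtain ⟨_, h, _⟩ := hσ
    exact ⟨u, h.1⟩

/-- Superfluous tokens can never be removed on the way to the home marking. -/
theorem IsHomeMarking.eq_zero_of_firesSeq_add (hconn : N.StronglyConnected) (hfc : N.FreeChoice)
    (hH : N.IsHomeMarking M (Marking.ofSet (N.pre t₀))) (L : Marking P) : ∀ (n : ℕ) (ρ : List T),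
    ρ.length = n → ∀ K ∈ N.reachable M,
    N.FiresSeq (K + L) ρ (Marking.ofSet (N.pre t₀)) → L = 0 := by
  classical
  intro n
  induction n with
  | zero =>
    intro ρ hρ K hK h
    obtain rfl := List.length_eq_zero_iff.1 hρ
    obtain ⟨u, hu⟩ := hH.exists_enabled hK
    have heq : K + L = Marking.ofSet (N.pre t₀) := h
    obtain ⟨p, hp⟩ := hconn.pre_nonempty u
    have hp₀ : p ∈ N.pre t₀ := by
      by_contra hn
      have h1 := congrFun heq p
      rw [ofSet_apply_notMem hn, Pi.add_apply] at h1
      have := hu p hp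
      omega
    have hle := hu.ofSet_le
    rw [hfc.pre_eq hp hp₀, ← heq] at hle
    funext p
    have := hle p
    simp only [Pi.add_apply, Pi.zero_apply] at this ⊢
    omega
  | succ n ih =>
    intro ρ hρ K hK h
    obtain ⟨u, hu⟩ := hH.exists_enabled hK
    by_cases hex : ∃ v ∈ ρ, N.pre v = N.pre u
    -- `eraseP` yields the first such `v`, so that nothing before it competes for its tokens.
    · obtain ⟨v, ρ₁, ρ₂, hne, hv, rfl, -⟩ :=
        List.exists_of_eraseP (p := fun v => decide (N.pre v = N.pre u))
          hex.choose_spec.1 (by simpa using hex.choose_spec.2)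
      have hv : N.pre v = N.pre u := by simpa using hv
      have hvK : N.Enabled K v := by
        unfold Enabled
        rw [hv]
        exact hu
      obtain ⟨K', hK'⟩ := hvK.exists_fires
      have hfire : N.Fires (K + L) v (K' + L) := by
        refine Fires.of_apply_add (fun p hp => ?_) fun p => ?_
        · have := hvK p hp
          simp only [Pi.add_apply]
          omega
        · have := hK'.apply_add p
          simp only [Pi.add_apply]
          omega
      refine ih (ρ₁ ++ ρ₂) ?_ K' (reachable_trans hK hK'.mem_reachable)
        (h.expedite (fun w hw => hfc.disjoint_pre ?_) hfire)
      · simp only [List.length_append, List.length_cons] at hρ ⊢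
        omega
      · rw [hv]
        simpa using hne w hw
    · exfalso
      push Not at hex
      have hcons : ∀ p ∈ N.pre u, N.consumed ρ p = 0 := fun p hp => by
        by_contra hn
        obtain ⟨v, hv, hpv⟩ := consumed_pos.1 (Nat.pos_of_ne_zero hn)
        exact hex v hv (hfc.pre_eq hpv hp)
      obtain ⟨p, hp⟩ := hconn.pre_nonempty u
      have hp₀ : p ∈ N.pre t₀ := by
        by_contra hn
        have h1 := h.apply_add p
        rw [ofSet_apply_notMem hn, hcons p hp, Pi.add_apply] at h1
        have := hu p hp
        omega
      have hpre := hfc.pre_eq hp hp₀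
      -- An output place `r` of the last transition is marked in `H`, hence is an input place of
      -- `u`. It had a token from the start, loses none and gains one, yet `H r ≤ 1`.
      rcases List.eq_nil_or_concat ρ with rfl | ⟨ρ', v, rfl⟩
      · simp at hρ
      rw [List.concat_eq_append] at *
      obtain ⟨K₁, -, K₂, hf, rfl⟩ := firesSeq_append.1 h
      obtain ⟨r, hr⟩ := hconn.post_nonempty v
      have h1 := hf.apply_add r
      rw [ofSet_apply_mem hr] at h1
      have h5 : 1 ≤ Marking.ofSet (N.pre t₀) r := by
        have h3 := ofSet_apply_le_one (N.pre v) r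
        by_cases hrv : r ∈ N.pre v
        · have := hf.1 r hrv
          omega
        · rw [ofSet_apply_notMem hrv] at h1
          omega
      have hr₀ : r ∈ N.pre t₀ := by
        by_contra hn
        rw [ofSet_apply_notMem hn] at h5
        omega
      have h2 := h.apply_add r
      have h3 := ofSet_apply_le_one (N.pre t₀) r
      have h4 : 0 < N.produced (ρ' ++ [v]) r := produced_pos.2 ⟨v, by simp, hr⟩
      rw [← hpre] at hr₀
      rw [hcons r hr₀, Pi.add_apply] at h2
      have := hu r hr₀
      omega

/-- Such a `K` is `H` plus a surplus, and `H` is itself reachable, so the surplus vanishes. -/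
theorem IsHomeMarking.eq_of_enabled (hconn : N.StronglyConnected) (hfc : N.FreeChoice)
    (hH : N.IsHomeMarking M (Marking.ofSet (N.pre t₀))) {K : Marking P}
    (hK : K ∈ N.reachable M) {t : T} (ht : N.pre t = N.pre t₀) (he : N.Enabled K t) :
    K = Marking.ofSet (N.pre t₀) := by
  have hle := he.ofSet_le
  rw [ht] at hle
  obtain ⟨ρ, hρ⟩ := hH K hK
  have hadd : Marking.ofSet (N.pre t₀) + (K - Marking.ofSet (N.pre t₀)) = K := by
    funext p
    exact Nat.add_sub_cancel' (hle p)
  have h0 := hH.eq_zero_of_firesSeq_add hconn hfc _ _ ρ rfl _ hH.mem_reachable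
    (hadd.symm ▸ hρ)
  rw [h0, add_zero] at hadd
  exact hadd.symm

/-- The home marking can be reached without firing a transition of the home cluster. -/
theorem IsHomeMarking.exists_firesSeq (hconn : N.StronglyConnected) (hfc : N.FreeChoice)
    (hH : N.IsHomeMarking M (Marking.ofSet (N.pre t₀))) {K : Marking P}
    (hK : K ∈ N.reachable M) :
    ∃ σ, (∀ t ∈ σ, N.pre t ≠ N.pre t₀) ∧ N.FiresSeq K σ (Marking.ofSet (N.pre t₀)) := by
  obtain ⟨σ, hσ⟩ := hH K hK
  induction σ generalizing K with
  | nil => exact ⟨[], by simp, hσ⟩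
  | cons t σ ih =>
    obtain ⟨K₁, h₁, h₂⟩ := hσ
    by_cases ht : N.pre t = N.pre t₀
    · exact ⟨[], by simp, hH.eq_of_enabled hconn hfc hK ht h₁.1⟩
    · obtain ⟨τ, hτ, hτ'⟩ := ih (reachable_trans hK h₁.mem_reachable) h₂
      refine ⟨t :: τ, fun u hu => ?_, K₁, h₁, hτ'⟩
      rcases List.mem_cons.1 hu with rfl | hu
      · exact ht
      · exact hτ u hu

/-! ### Acyclic allocations -/

/-- Every place of `S` lies in `Q` or is an input place of a transition of `τ`. -/
def SupportedOn (N : PetriNet P T) (Q : Set P) (τ : List T) (S : Set P) : Prop :=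
  ∀ p ∈ S, p ∈ Q ∨ ∃ t ∈ τ, p ∈ N.pre t

/-- At most one transition of each cluster occurs in `τ`, none that consumes from `Q`, and tokens
produced by a transition of `τ` lie in `Q` or are consumed by a later one. -/
def Acyclic (N : PetriNet P T) (Q : Set P) : List T → Prop
  | [] => True
  | t :: τ => N.pre t ≠ Q ∧ N.SupportedOn Q τ (N.post t) ∧ (∀ u ∈ τ, N.pre u ≠ N.pre t) ∧
      N.Acyclic Q τ

theorem SupportedOn.mono {Q S : Set P} {τ τ' : List T} (h : N.SupportedOn Q τ S) (hτ : τ ⊆ τ') :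
    N.SupportedOn Q τ' S := fun p hp =>
  (h p hp).imp_right fun ⟨t, ht, hpt⟩ => ⟨t, hτ ht, hpt⟩

theorem Acyclic.pre_ne {Q : Set P} {τ : List T} (h : N.Acyclic Q τ) : ∀ t ∈ τ, N.pre t ≠ Q := by
  induction τ with
  | nil => simp
  | cons t τ ih =>
    intro u hu
    rcases List.mem_cons.1 hu with rfl | hu
    · exact h.1
    · exact ih h.2.2.2 u hu

theorem Acyclic.supportedOn_post {Q : Set P} {τ : List T} (h : N.Acyclic Q τ) :
    ∀ t ∈ τ, N.SupportedOn Q τ (N.post t) := by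
  induction τ with
  | nil => simp
  | cons t τ ih =>
    intro u hu
    rcases List.mem_cons.1 hu with rfl | hu
    · exact h.2.1.mono (List.subset_cons_self _ _)
    · exact (ih h.2.2.2 u hu).mono (List.subset_cons_self _ _)

theorem Acyclic.eq_of_pre_eq {Q : Set P} {τ : List T} (h : N.Acyclic Q τ) :
    ∀ t ∈ τ, ∀ u ∈ τ, N.pre t = N.pre u → t = u := by
  induction τ with
  | nil => simp
  | cons v τ ih =>
    intro t ht u hu heq
    rcases List.mem_cons.1 ht with rfl | ht' <;> rcases List.mem_cons.1 hu with rfl | hu'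
    · rfl
    · exact (h.2.2.1 u hu' heq.symm).elim
    · exact (h.2.2.1 t ht' heq).elim
    · exact ih h.2.2.2 t ht' u hu' heq

/-- The transitions fired last in their clusters, on the way to a marking of `Q`, form an acyclic
allocation. -/
theorem FiresSeq.exists_acyclic {Q : Set P} {τ₀ : List T}
    (hτ₀ : N.Acyclic Q τ₀) {σ : List T} : ∀ {K : Marking P},
    N.FiresSeq K σ (Marking.ofSet Q) → (∀ t ∈ σ, N.pre t ≠ Q) →
    ∃ τ, N.Acyclic Q τ ∧ τ₀ ⊆ τ ∧ N.SupportedOn Q τ {p | 1 ≤ K p} := by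
  induction σ with
  | nil =>
    intro K h _
    obtain rfl : K = _ := h
    refine ⟨τ₀, hτ₀, List.Subset.refl _, fun p hp => .inl ?_⟩
    by_contra hn
    simp [ofSet_apply_notMem hn] at hp
  | cons t σ ih =>
    rintro K ⟨K₁, h₁, h₂⟩ hσ
    obtain ⟨τ, hτ, hsub, hsup⟩ := ih h₂ fun u hu => hσ u (by simp [hu])
    have hK : ∀ p, 1 ≤ K p → p ∈ N.pre t ∨ 1 ≤ K₁ p := fun p hp => by
      by_cases hpt : p ∈ N.pre t
      · exact .inl hpt
      · have := h₁.apply_add p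
        rw [ofSet_apply_notMem hpt] at this
        exact .inr (by omega)
    by_cases hex : ∃ u ∈ τ, N.pre u = N.pre t
    · obtain ⟨u, hu, hut⟩ := hex
      -- The cluster already has its representative, from a later firing or from `τ₀`; it is kept.
      exact ⟨τ, hτ, hsub, fun p hp => (hK p hp).elim (fun h => .inr ⟨u, hu, hut ▸ h⟩) (hsup p)⟩
    · push Not at hex
      refine ⟨t :: τ, ⟨hσ t (by simp), fun p hp => hsup p ?_, hex, hτ⟩,
        fun u hu => List.mem_cons_of_mem _ (hsub hu), fun p hp => ?_⟩
      · have h1 := h₁.apply_add p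
        rw [ofSet_apply_mem hp] at h1
        have h3 := ofSet_apply_le_one (N.pre t) p
        show 1 ≤ K₁ p
        by_cases hrv : p ∈ N.pre t
        · have := h₁.1 p hrv
          omega
        · rw [ofSet_apply_notMem hrv] at h1
          omega
      · rcases hK p hp with h | h
        · exact .inr ⟨t, by simp, h⟩
        · exact (hsup.mono (List.subset_cons_self _ _)) p h

theorem exists_firesSeq_replicate {t : T} {p : P} (hp : p ∈ N.pre t) (hp' : p ∉ N.post t) :
    ∀ (n : ℕ) (K : Marking P), K p = n → ∃ k K', N.FiresSeq K (List.replicate k t) K' ∧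
      ¬ N.Enabled K' t := by
  intro n
  induction n with
  | zero =>
    intro K hK
    refine ⟨0, K, rfl, fun h => ?_⟩
    have := h p hp
    omega
  | succ n ih =>
    intro K hK
    by_cases he : N.Enabled K t
    · obtain ⟨K₁, h₁⟩ := he.exists_fires
      have := h₁.apply_add p
      rw [ofSet_apply_mem hp, ofSet_apply_notMem hp'] at this
      obtain ⟨k, K', h, hn⟩ := ih K₁ (by omega)
      exact ⟨k + 1, K', ⟨K₁, h₁, h⟩, hn⟩
    · exact ⟨0, K, rfl, he⟩

/-- An acyclic allocation can be fired to exhaustion. -/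
theorem Acyclic.exists_exhausted (hconn : N.StronglyConnected) (hfc : N.FreeChoice) {τ : List T}
    (hτ : N.Acyclic (N.pre t₀) τ) : ∀ K : Marking P, ∃ w K', N.FiresSeq K w K' ∧ w ⊆ τ ∧
      ∀ t ∈ τ, ¬ N.Enabled K' t := by
  induction τ with
  | nil => exact fun K => ⟨[], K, rfl, by simp, by simp⟩
  | cons t τ ih =>
    intro K
    obtain ⟨hne, hpost, hdis, hτ'⟩ := hτ
    -- Neither `t` nor the later transitions put tokens on the input places of `t`: it fires
    -- finitely often and, once disabled, stays so.
    have hout : ∀ S, N.SupportedOn (N.pre t₀) τ S → ∀ p ∈ N.pre t, p ∉ S := by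
      intro S hS p hp hpS
      rcases hS p hpS with h | ⟨u, hu, hpu⟩
      · exact hne (hfc.pre_eq hp h)
      · exact hdis u hu (hfc.pre_eq hpu hp)
    obtain ⟨p, hp⟩ := hconn.pre_nonempty t
    obtain ⟨k, K₁, h₁, hn₁⟩ := exists_firesSeq_replicate hp (hout _ hpost p hp) _ K rfl
    obtain ⟨w, K', h₂, hw, hn⟩ := ih hτ' K₁
    refine ⟨List.replicate k t ++ w, K', firesSeq_append.2 ⟨K₁, h₁, h₂⟩, fun u hu => ?_,
      fun u hu => ?_⟩
    · rcases List.mem_append.1 hu with hu | hu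
      · simp [List.eq_of_mem_replicate hu]
      · exact List.mem_cons_of_mem _ (hw hu)
    · rcases List.mem_cons.1 hu with rfl | hu
      · refine fun he => hn₁ fun r hr => ?_
        have h1 := h₂.apply_add r
        have h2 : N.produced w r = 0 := by
          by_contra hne0
          obtain ⟨v, hv, hrv⟩ := produced_pos.1 (Nat.pos_of_ne_zero hne0)
          exact hout _ (hτ'.supportedOn_post v (hw hv)) r hr hrv
        have := he r hr
        omega
      · exact hn u hu

theorem FiresSeq.supportedOn {Q : Set P} {τ w : List T} (hτ : N.Acyclic Q τ) (hw : w ⊆ τ)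
    {K K' : Marking P} (h : N.FiresSeq K w K') (hK : N.SupportedOn Q τ {p | 1 ≤ K p}) :
    N.SupportedOn Q τ {p | 1 ≤ K' p} := by
  intro p hp
  have h1 := h.apply_add p
  have hp : 1 ≤ K' p := hp
  by_cases h0 : N.produced w p = 0
  · exact hK p (show 1 ≤ K p by omega)
  · obtain ⟨t, ht, hpt⟩ := produced_pos.1 (Nat.pos_of_ne_zero h0)
    exact hτ.supportedOn_post t (hw ht) p hpt

/-- Any acyclic allocation that supports a reachable marking leads from it to the home marking. -/
theorem IsHomeMarking.exists_firesSeq_of_acyclic (hconn : N.StronglyConnected)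
    (hfc : N.FreeChoice) (hH : N.IsHomeMarking M (Marking.ofSet (N.pre t₀))) {K : Marking P}
    (hK : K ∈ N.reachable M) {τ : List T} (hτ : N.Acyclic (N.pre t₀) τ)
    (hs : N.SupportedOn (N.pre t₀) τ {p | 1 ≤ K p}) :
    ∃ w, w ⊆ τ ∧ N.FiresSeq K w (Marking.ofSet (N.pre t₀)) := by
  obtain ⟨w, K', h, hw, hn⟩ := hτ.exists_exhausted hconn hfc K
  have hK' : K' ∈ N.reachable M := reachable_trans hK ⟨w, h⟩
  obtain ⟨u, hu⟩ := hH.exists_enabled hK'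
  obtain ⟨p, hp⟩ := hconn.pre_nonempty u
  rcases h.supportedOn hτ hw hs p (hu p hp) with hp₀ | ⟨t, ht, hpt⟩
  · exact ⟨w, hw, hH.eq_of_enabled hconn hfc hK' (hfc.pre_eq hp hp₀) hu ▸ h⟩
  · refine (hn t ht ?_).elim
    unfold Enabled
    rw [hfc.pre_eq hpt hp]
    exact hu

/-! ### Firing counts along an acyclic allocation, safety and lucency -/

theorem Acyclic.consumed_eq_zero (hfc : N.FreeChoice) {τ w : List T}
    (hτ : N.Acyclic (N.pre t₀) τ) (hw : w ⊆ τ) {p : P} (hp : p ∈ N.pre t₀) :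
    N.consumed w p = 0 := by
  by_contra hn
  obtain ⟨t, ht, hpt⟩ := consumed_pos.1 (Nat.pos_of_ne_zero hn)
  exact hτ.pre_ne t (hw ht) (hfc.pre_eq hpt hp)

/-- Induction from the end of `τ`: each firing of `t` feeds an output place `r`, which either keeps
its tokens until `H`, at most one, or passes all of them to a later transition that is already
bounded. -/
theorem Acyclic.consumed_le_one (hconn : N.StronglyConnected) (hfc : N.FreeChoice)
    {τ w : List T} (hτ : N.Acyclic (N.pre t₀) τ) (hw : w ⊆ τ) {K : Marking P}
    (h : N.FiresSeq K w (Marking.ofSet (N.pre t₀))) :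
    ∀ t ∈ τ, ∀ p ∈ N.pre t, N.consumed w p ≤ 1 := by
  have key : ∀ τ' : List T, N.Acyclic (N.pre t₀) τ' → τ' ⊆ τ →
      ∀ t ∈ τ', ∀ p ∈ N.pre t, N.consumed w p ≤ 1 := by
    intro τ'
    induction τ' with
    | nil => simp
    | cons v τ' ih =>
      intro hac hsub t ht p hp
      have ih := ih hac.2.2.2 fun u hu => hsub (List.mem_cons_of_mem _ hu)
      rcases List.mem_cons.1 ht with rfl | ht
      swap
      · exact ih t ht p hp
      obtain ⟨r, hr⟩ := hconn.post_nonempty t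
      -- Within `w`, only `t` itself consumes from `p`.
      have hle : N.consumed w p ≤ N.produced w r := by
        refine List.countP_mono_left fun u hu hpu => ?_
        have hpu : p ∈ N.pre u := by simpa using hpu
        have := hτ.eq_of_pre_eq u (hw hu) t (hsub (by simp)) (hfc.pre_eq hpu hp)
        simpa [this] using hr
      have h1 := h.apply_add r
      rcases hac.2.1 r hr with hr₀ | ⟨u, hu, hru⟩
      · rw [hτ.consumed_eq_zero hfc hw hr₀] at h1
        have := ofSet_apply_le_one (N.pre t₀) r
        omega
      · have hr₀ : r ∉ N.pre t₀ := fun hr₀ =>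
          hac.pre_ne u (List.mem_cons_of_mem _ hu) (hfc.pre_eq hru hr₀)
        rw [ofSet_apply_notMem hr₀] at h1
        have := ih u hu r hru
        omega
  exact key τ hτ (List.Subset.refl _)

theorem Acyclic.nodup (hconn : N.StronglyConnected) (hfc : N.FreeChoice)
    {τ w : List T} (hτ : N.Acyclic (N.pre t₀) τ) (hw : w ⊆ τ) {K : Marking P}
    (h : N.FiresSeq K w (Marking.ofSet (N.pre t₀))) : w.Nodup := by
  classical
  refine List.nodup_iff_count_le_one.2 fun t => ?_
  by_cases ht : t ∈ w
  · obtain ⟨p, hp⟩ := hconn.pre_nonempty t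
    refine le_trans ?_ (hτ.consumed_le_one hconn hfc hw h t (hw ht) p hp)
    refine List.countP_mono_left fun u _ hut => ?_
    have : u = t := by simpa using hut
    simpa [this] using hp
  · simp [List.count_eq_zero_of_not_mem ht]

theorem IsHomeMarking.safe (hconn : N.StronglyConnected) (hfc : N.FreeChoice)
    (hH : N.IsHomeMarking M (Marking.ofSet (N.pre t₀))) : N.Safe M := by
  intro K hK p
  obtain ⟨σ, hσ, hσ'⟩ := hH.exists_firesSeq hconn hfc hK
  obtain ⟨τ, hτ, -, hs⟩ := hσ'.exists_acyclic (τ₀ := []) trivial hσ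
  obtain ⟨w, hw, h⟩ := hH.exists_firesSeq_of_acyclic hconn hfc hK hτ hs
  have h1 := h.apply_add p
  by_contra! hlt
  rcases hs p (show 1 ≤ K p by omega) with hp₀ | ⟨t, ht, hpt⟩
  · have := ofSet_apply_le_one (N.pre t₀) p
    rw [hτ.consumed_eq_zero hfc hw hp₀] at h1
    omega
  · have hp₀ : p ∉ N.pre t₀ := fun hp₀ => hτ.pre_ne t ht (hfc.pre_eq hpt hp₀)
    rw [ofSet_apply_notMem hp₀] at h1
    have := hτ.consumed_le_one hconn hfc hw h t ht p hpt
    omega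

/-- A token that is ever on an input place of `t ∈ τ` during `w` must be gone in `H`, and only `t`
can remove it. A transition of `l` is either enabled in `K₁`, hence in `K₂`, or fed by an earlier
one of `l`, which is in `w` by induction. -/
theorem Acyclic.subset_of_en_subset (hconn : N.StronglyConnected) (hfc : N.FreeChoice)
    {τ w : List T} (hτ : N.Acyclic (N.pre t₀) τ) (hw : w ⊆ τ) {K₁ K₂ : Marking P}
    (hen : N.en K₁ ⊆ N.en K₂) (h : N.FiresSeq K₂ w (Marking.ofSet (N.pre t₀))) (l : List T) :
    ∀ K', N.FiresSeq K₁ l K' → l ⊆ τ → l ⊆ w := by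
  have key : ∀ t ∈ τ, ∀ p ∈ N.pre t, 0 < K₂ p + N.produced w p → t ∈ w := by
    intro t ht p hp hpos
    have h1 := h.apply_add p
    rw [ofSet_apply_notMem fun hp₀ => hτ.pre_ne t ht (hfc.pre_eq hp hp₀)] at h1
    obtain ⟨u, hu, hpu⟩ := consumed_pos.1 (show 0 < N.consumed w p by omega)
    exact hτ.eq_of_pre_eq u (hw hu) t ht (hfc.pre_eq hpu hp) ▸ hu
  induction l using List.reverseRecOn with
  | nil => simp
  | append_singleton l t ih =>
    intro K' hK' hl u hu
    obtain ⟨K, hK, _, hf, -⟩ := firesSeq_append.1 hK'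
    have ih := ih K hK fun v hv => hl (by simp [hv])
    rcases List.mem_append.1 hu with hu | hu
    · exact ih hu
    obtain rfl : u = t := by simpa using hu
    by_cases he : N.Enabled K₁ u
    · obtain ⟨p, hp⟩ := hconn.pre_nonempty u
      have := hen he p hp
      exact key u (hl (by simp)) p hp (by omega)
    · unfold Enabled at he
      push Not at he
      obtain ⟨p, hp, h0⟩ := he
      have h1 := hK.apply_add p
      have h2 := hf.1 p hp
      obtain ⟨v, hv, hpv⟩ := produced_pos.1 (show 0 < N.produced l p by omega)
      have : 0 < N.produced w p := produced_pos.2 ⟨v, ih hv, hpv⟩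
      exact key u (hl (by simp)) p hp (by omega)

theorem IsHomeMarking.lucent (hconn : N.StronglyConnected) (hfc : N.FreeChoice)
    (hH : N.IsHomeMarking M (Marking.ofSet (N.pre t₀))) : N.Lucent M := by
  intro K₁ hK₁ K₂ hK₂ hen
  obtain ⟨σ₂, hσ₂, hσ₂'⟩ := hH.exists_firesSeq hconn hfc hK₂
  obtain ⟨τ₂, hτ₂, -, hs₂⟩ := hσ₂'.exists_acyclic (τ₀ := []) trivial hσ₂
  obtain ⟨σ₁, hσ₁, hσ₁'⟩ := hH.exists_firesSeq hconn hfc hK₁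
  -- Extending `τ₂` gives one allocation that supports both markings.
  obtain ⟨τ, hτ, hsub, hs₁⟩ := hσ₁'.exists_acyclic hτ₂ hσ₁
  obtain ⟨w₁, hw₁, h₁⟩ := hH.exists_firesSeq_of_acyclic hconn hfc hK₁ hτ hs₁
  obtain ⟨w₂, hw₂, h₂⟩ := hH.exists_firesSeq_of_acyclic hconn hfc hK₂ hτ (hs₂.mono hsub)
  have h12 := hτ.subset_of_en_subset hconn hfc hw₂ hen.subset h₂ w₁ _ h₁ hw₁
  have h21 := hτ.subset_of_en_subset hconn hfc hw₁ hen.superset h₁ w₂ _ h₂ hw₂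
  have hperm : w₁.Perm w₂ :=
    (List.perm_ext_iff_of_nodup (hτ.nodup hconn hfc hw₁ h₁) (hτ.nodup hconn hfc hw₂ h₂)).2
      fun t => ⟨fun h => h12 h, fun h => h21 h⟩
  funext p
  have e1 := h₁.apply_add p
  have e2 := h₂.apply_add p
  have e3 : N.produced w₁ p = N.produced w₂ p := hperm.countP_eq _
  have e4 : N.consumed w₁ p = N.consumed w₂ p := hperm.countP_eq _
  omega

end Home

end PetriNet

theorem mainTheorem8 {P T : Type*} (N : PetriNet P T) (M : Marking P)
    (hconn : N.StronglyConnected) (hfc : N.FreeChoice)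
    (hhome : ∃ C : Set (P ⊕ T), N.IsHomeCluster M C) :
    N.Live M ∧ N.Safe M ∧ N.Lucent M := by
  obtain ⟨_, ⟨x, rfl⟩, hH⟩ := hhome
  obtain ⟨t₀, ht₀⟩ := PetriNet.exists_mrk_cluster_eq hconn hfc x
  rw [ht₀] at hH
  exact ⟨hH.live hconn hfc, hH.safe hconn hfc, hH.lucent hconn hfc⟩
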